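/- Let $X$ be a scheme, let $\mathcal{O}_X\text{-Mod}$ be the category of sheaves of $\mathcal{O}_X$-modules, and let $\mathfrak{Qcoh}(X)$ be its full subcategory of quasi-coherent sheaves. An object $H$ of a category is called finitely presented if $\operatorname{Hom}(H,-)$ preserves direct limits; an additive category with direct limits is called locally finitely presented if its finitely presented objects have a small skeleton and every object is a direct limit of finitely presented objects. For $\mathcal{O}_X$-modules $\mathscr{M},\mathscr{N}$, the tensor product $\mathscr{M}\otimes\mathscr{N}$ is the sheafification of $U\mapsto \mathscr{M}(U)\otimes_{\mathcal{O}_X(U)}\mathscr{N}(U)$. Let $\mathbf{Pure_{fp}}$ be the class of short exact sequences $0\to\mathscr{F}\to\mathscr{G}\to\mathscr{T}\to 0$ in $\mathfrak{Qcoh}(X)$ such that $$0\to\operatorname{Hom}(\mathscr{H},\mathscr{F})\to\operatorname{Hom}(\mathscr{H},\mathscr{G})\to\operatorname{Hom}(\mathscr{H},\mathscr{T})\to 0$$ is exact for every finitely presented object $\mathscr{H}$ of $\mathfrak{Qcoh}(X)$. Let $\mathbf{Pure}$ be the class of short exact sequences $0\to\mathscr{F}\xrightarrow{\tau}\mathscr{G}\to\mathscr{T}\to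 0$ in $\mathfrak{Qcoh}(X)$ such that $\tau$ is a monomorphism in $\mathcal{O}_X\text{-Mod}$ and $$0\to\mathscr{M}\otimes\mathscr{F}\xrightarrow{\mathrm{id}\otimes\tau}\mathscr{M}\otimes\mathscr{G}$$ is exact for every $\mathcal{O}_X$-module $\mathscr{M}$ (not only the quasi-coherent ones). If $\mathfrak{Qcoh}(X)$ is locally finitely presented, then $\mathbf{Pure_{fp}}\subseteq\mathbf{Pure}$. -/

import Mathlib

open CategoryTheory Limits AlgebraicGeometry MonoidalCategory Opposite

universe u

noncomputable section

namespace QcohPurity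

/-- Quasi-coherence as a property of `𝒪_X`-modules. -/
def isQcoh (X : Scheme.{u}) : ObjectProperty X.Modules :=
  fun M => SheafOfModules.IsQuasicoherent M

/-- The category of quasi-coherent `𝒪_X`-modules, a full subcategory of `𝒪_X`-Mod. -/
abbrev Qcoh (X : Scheme.{u}) : Type (u + 1) := (isQcoh X).FullSubcategory

/-- The functor `P ⊗ -` on presheaves of `𝒪_X`-modules, `Q ↦ (U ↦ P(U) ⊗_{𝒪_X(U)} Q(U))`. -/
def presheafTensorLeft {X : Scheme.{u}} (P : X.PresheafOfModules) :
    X.PresheafOfModules ⥤ X.PresheafOfModules :=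
  tensorLeft (C := PresheafOfModules.{u} (X.presheaf ⋙ forget₂ CommRingCat RingCat)) P

/-- The sheafification functor from presheaves of `𝒪_X`-modules to `𝒪_X`-Mod. -/
def sheafify (X : Scheme.{u}) : X.PresheafOfModules ⥤ X.Modules :=
  PresheafOfModules.sheafification (𝟙 X.ringCatSheaf.obj)

/-- The functor `M ⊗ -` on `𝒪_X`-Mod: `M ⊗ N` is the sheafification of the presheaf
`U ↦ M(U) ⊗_{𝒪_X(U)} N(U)`. -/
def tensorLeftFunctor {X : Scheme.{u}} (M : X.Modules) : X.Modules ⥤ X.Modules :=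
  Scheme.Modules.toPresheafOfModules X ⋙
    presheafTensorLeft ((Scheme.Modules.toPresheafOfModules X).obj M) ⋙ sheafify X

/-- A monomorphism `0 ⟶ F ⟶ G` of `𝒪_X`-modules is pure exact if it stays a monomorphism after
tensoring with an arbitrary (not necessarily quasi-coherent) `𝒪_X`-module. -/
structure IsPureExact {X : Scheme.{u}} {F G : X.Modules} (τ : F ⟶ G) : Prop where
  mono : Mono τ
  mono_tensor (M : X.Modules) : Mono ((tensorLeftFunctor M).map τ)

/-- An additive category is locally finitely presented if it has filtered colimits, its finitely
presented objects form an essentially small class, and every object is a filtered colimit of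
finitely presented ones. -/
structure IsLocallyFinitelyPresented (C : Type (u + 1)) [Category.{u} C] : Prop where
  hasFilteredColimits : HasFilteredColimitsOfSize.{u, u} C
  essentiallySmall :
    ObjectProperty.EssentiallySmall.{u} (ObjectProperty.isFinitelyPresentable.{u} C)
  exists_colimit (A : C) : ∃ (J : Type u) (_ : SmallCategory J) (_ : IsFiltered J),
    (ObjectProperty.isFinitelyPresentable.{u} C).colimitsOfShape J A

/-- The class of categorically pure (fp-pure) short exact sequences in `Qcoh(X)`: short exact
sequences that stay exact under `Hom(H, -)` for every finitely presented object `H` of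
`Qcoh(X)`. -/
def pureFp (X : Scheme.{u}) : ObjectProperty (ShortComplex (Qcoh X)) :=
  fun E => E.ShortExact ∧ ∀ H : Qcoh X, IsFinitelyPresentable.{u} H →
    (E.map (preadditiveCoyoneda.obj (op H))).ShortExact

/-- The class of short exact sequences `0 ⟶ F ⟶ G ⟶ T ⟶ 0` in `Qcoh(X)` such that
`0 ⟶ F ⟶ G` is pure exact in `𝒪_X`-Mod. -/
def pure (X : Scheme.{u}) : ObjectProperty (ShortComplex (Qcoh X)) :=
  fun E => E.ShortExact ∧ IsPureExact ((isQcoh X).ι.map E.f)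

end QcohPurity

end

/-! Monomorphy after sheafification can be tested on affine opens `U`, so it suffices that `F(U) →
G(U)` is universally injective; this handles every `M(U)`, whether or not `M` is quasi-coherent. By
the equational criterion (`lTensor_injective_of_forall_exists_solution`), one must turn a solution
`y` in `G(U)` of a finite linear system with constants in `F(U)` into a solution in `F(U)`. Write
`T` as a filtered colimit of finitely presented objects. Sections over `U` commute with this
colimit, so the images of the `y j` in `T(U)`, together with their finitely many relations, lift to
sections `t j` of a single finitely presented `H`. Purity lifts `H ⟶ T` to `s : H ⟶ G`, and `y j - s
(t j)` lies in `F(U)` and solves the system (`exists_solution_of_pureFp`). -/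

noncomputable section

namespace QcohPurity

/-! ### Universal injectivity and linear equations -/

section Algebra

variable {R : Type*} [CommRing R] {F G M : Type*} [AddCommGroup F] [Module R F]
  [AddCommGroup G] [Module R G] [AddCommGroup M] [Module R M]

/-- Elements of `M ⊗ N` can be written in terms of a fixed finite generating family of `M`. -/
lemma exists_sum_tmul_eq_of_span_eq_top {ι : Type*} [Fintype ι] (m : ι → M)
    (hm : Submodule.span R (Set.range m) = ⊤) (x : TensorProduct R M F) :
    ∃ n : ι → F, x = ∑ i, m i ⊗ₜ[R] n i := by
  induction x with
  | zero => exact ⟨0, by simp⟩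
  | tmul p q =>
    obtain ⟨c, hc⟩ := (Submodule.mem_span_range_iff_exists_fun R).mp
      (hm ▸ Submodule.mem_top : p ∈ Submodule.span R (Set.range m))
    exact ⟨fun i ↦ c i • q, by simp [← hc, TensorProduct.sum_tmul, TensorProduct.smul_tmul]⟩
  | add x y hx hy =>
    obtain ⟨a, rfl⟩ := hx
    obtain ⟨b, rfl⟩ := hy
    exact ⟨a + b, by simp [TensorProduct.tmul_add, Finset.sum_add_distrib]⟩

/-- A linear map `f` is universally injective if finite systems of linear equations with
constants in the source that are solvable in the target are solvable in the source. -/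
lemma lTensor_injective_of_forall_exists_solution (f : F →ₗ[R] G)
    (H : ∀ (n k : ℕ) (a : Fin n → Fin k → R) (x : Fin n → F) (y : Fin k → G),
      (∀ i, f (x i) = ∑ j, a i j • y j) → ∃ z : Fin k → F, ∀ i, x i = ∑ j, a i j • z j) :
    Function.Injective (f.lTensor M) := by
  rw [injective_iff_map_eq_zero]
  intro t ht
  obtain ⟨P, hP, s, rfl⟩ := TensorProduct.exists_of_fg t
  have h0 : P.subtype.rTensor G (f.lTensor P s) = P.subtype.rTensor G 0 := by
    rw [map_zero, ← ht, ← LinearMap.comp_apply, ← LinearMap.comp_apply,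
      LinearMap.rTensor_comp_lTensor, LinearMap.lTensor_comp_rTensor]
  obtain ⟨Q, hPQ, hQ, h⟩ := TensorProduct.eq_of_fg_of_subtype_eq hP h0
  rw [map_zero, ← LinearMap.comp_apply, LinearMap.rTensor_comp_lTensor,
    ← LinearMap.lTensor_comp_rTensor, LinearMap.comp_apply] at h
  suffices (Submodule.inclusion hPQ).rTensor F s = 0 by
    rw [← Submodule.subtype_comp_inclusion P Q hPQ, LinearMap.rTensor_comp, LinearMap.comp_apply,
      this, map_zero]
  generalize (Submodule.inclusion hPQ).rTensor F s = s' at h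
  -- Passing to a finitely generated `Q` provides finite generators `m`, for which a vanishing sum
  -- `∑ m i ⊗ f (x i)` is explained by linear relations.
  have : Module.Finite R Q := Module.Finite.iff_fg.mpr hQ
  obtain ⟨n, m, hm⟩ := Module.Finite.exists_fin (R := R) (M := Q)
  obtain ⟨x, rfl⟩ := exists_sum_tmul_eq_of_span_eq_top m hm s'
  simp only [map_sum, LinearMap.lTensor_tmul] at h
  obtain ⟨k, a, y, h₁, h₂⟩ := TensorProduct.vanishesTrivially_of_sum_tmul_eq_zero R hm h
  obtain ⟨z, hz⟩ := H n k a x y h₁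
  exact TensorProduct.sum_tmul_eq_zero_of_vanishesTrivially R ⟨k, a, z, hz, h₂⟩

end Algebra

/-! ### Filtered colimits of abelian groups -/

section FilteredColimit

variable {J : Type u} [SmallCategory J] [IsFiltered J] {D : J ⥤ AddCommGrpCat.{u}} {c : Cocone D}

/-- A finite family of elements of a filtered colimit lifts to a common stage. -/
lemma exists_rep_of_finite (hc : IsColimit c) {κ : Type*} [Finite κ] (t : κ → c.pt) :
    ∃ (i : J) (h : κ → D.obj i), ∀ j, c.ι.app i (h j) = t j := by
  choose i h hi using fun j ↦ Concrete.isColimit_exists_rep D hc (t j)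
  classical
  have := Fintype.ofFinite κ
  obtain ⟨s, hs⟩ := IsFiltered.sup_objs_exists (Finset.univ.image i)
  have φ (j : κ) : i j ⟶ s := (hs (Finset.mem_image_of_mem _ (Finset.mem_univ j))).some
  exact ⟨s, fun j ↦ D.map (φ j) (h j), fun j ↦ by
    rw [← hi j, ← ConcreteCategory.comp_apply, c.w]⟩

/-- A finite family of elements vanishing in a filtered colimit vanishes at some stage. -/
lemma exists_map_eq_zero_of_finite (hc : IsColimit c) {κ : Type*} [Finite κ] {i : J}
    (w : κ → D.obj i) (hw : ∀ j, c.ι.app i (w j) = 0) :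
    ∃ (i' : J) (φ : i ⟶ i'), ∀ j, D.map φ (w j) = 0 := by
  have := Fintype.ofFinite κ
  suffices ∀ s : Finset κ, ∃ (i' : J) (φ : i ⟶ i'), ∀ j ∈ s, D.map φ (w j) = 0 by
    simpa using this Finset.univ
  intro s
  classical
  induction s using Finset.induction_on with
  | empty => exact ⟨i, 𝟙 i, by simp⟩
  | insert a s _ ih =>
    obtain ⟨i', φ, h⟩ := ih
    have h0 : c.ι.app i' (D.map φ (w a)) = c.ι.app i' 0 := by
      rw [map_zero, ← ConcreteCategory.comp_apply, c.w, hw]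
    obtain ⟨k, p, q, hpq⟩ := Concrete.isColimit_exists_of_rep_eq D hc _ _ h0
    refine ⟨k, φ ≫ p, fun j hj ↦ ?_⟩
    rw [Functor.map_comp, ConcreteCategory.comp_apply]
    rcases Finset.mem_insert.mp hj with rfl | hj
    · rw [hpq, map_zero]
    · rw [h j hj, map_zero]

end FilteredColimit

/-! ### Sheafification and sections -/

variable {X : Scheme.{u}}

/-- A morphism of presheaves of modules that is injective on affine opens becomes a monomorphism
after sheafification. -/
lemma mono_sheafify_map_of_injective_affine {P Q : X.PresheafOfModules} (φ : P ⟶ Q)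
    (h : ∀ U : X.Opens, IsAffineOpen U → Function.Injective (φ.app (op U))) :
    Mono ((sheafify X).map φ) := by
  have hinj : Presheaf.IsLocallyInjective (Opens.grothendieckTopology X)
      ((PresheafOfModules.toPresheaf _).map φ) := by
    refine ⟨fun {V} x y hxy p hp ↦ ?_⟩
    obtain ⟨_, ⟨U, hU, rfl⟩, hpU, hUV⟩ :=
      X.isBasis_affineOpens.exists_subset_of_mem_open hp V.unop.2
    refine ⟨U, homOfLE hUV, ?_, hpU⟩
    apply h U hU
    have e := fun z ↦ ConcreteCategory.congr_hom
      (((PresheafOfModules.toPresheaf _).map φ).naturality (homOfLE hUV).op) z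
    exact (e x).trans ((congrArg (Q.presheaf.map (homOfLE hUV).op) hxy).trans (e y).symm)
  apply (SheafOfModules.toSheaf X.ringCatSheaf).mono_of_mono_map
  have : Sheaf.IsLocallyInjective ((presheafToSheaf (Opens.grothendieckTopology X)
      AddCommGrpCat.{u}).map ((PresheafOfModules.toPresheaf _).map φ)) :=
    (Presheaf.isLocallyInjective_presheafToSheaf_map_iff _ _).mpr hinj
  exact Sheaf.mono_of_isLocallyInjective ((presheafToSheaf (Opens.grothendieckTopology X)
      AddCommGrpCat.{u}).map ((PresheafOfModules.toPresheaf _).map φ))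

/-- The action of a morphism of `𝒪_X`-modules on sections, as a linear map. -/
def appLinearMap {F G : X.Modules} (τ : F ⟶ G) (U : X.Opens) : Γ(F, U) →ₗ[Γ(X, U)] Γ(G, U) where
  toFun := τ.app U
  map_add' := map_add _
  map_smul' := τ.app_smul

/-- A morphism of `𝒪_X`-modules that is universally injective on affine opens stays a monomorphism
after tensoring. -/
lemma mono_tensorLeftFunctor_map {F G : X.Modules} (τ : F ⟶ G) (M : X.Modules)
    (h : ∀ U : X.Opens, IsAffineOpen U →
      Function.Injective ((appLinearMap τ U).lTensor Γ(M, U))) :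
    Mono ((tensorLeftFunctor M).map τ) :=
  mono_sheafify_map_of_injective_affine _ fun U hU ↦ h U hU

/-- The functor of sections over `U`, with values in abelian groups. -/
def sections (U : X.Opens) : X.Modules ⥤ AddCommGrpCat.{u} :=
  Scheme.Modules.toPresheaf X ⋙ (evaluation X.Opensᵒᵖ AddCommGrpCat.{u}).obj (op U)

instance (U : X.Opens) : (sections U).PreservesZeroMorphisms := ⟨fun _ _ ↦ rfl⟩

instance (U : X.Opens) : PreservesLimits (sections U) :=
  have : PreservesLimits ((evaluation X.Opensᵒᵖ AddCommGrpCat.{u}).obj (op U)) :=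
    ⟨fun {J} _ ↦ evaluation_preservesLimitsOfShape (K := X.Opensᵒᵖ) (J := J) (op U)⟩
  comp_preservesLimits (Scheme.Modules.toPresheaf X)
    ((evaluation X.Opensᵒᵖ AddCommGrpCat.{u}).obj (op U))

instance (U : X.Opens) : PreservesFiniteLimits (sections U) :=
  PreservesLimits.preservesFiniteLimits _

lemma injective_app_of_mono {F G : X.Modules} (τ : F ⟶ G) [Mono τ] (U : X.Opens) :
    Function.Injective (τ.app U) :=
  (AddCommGrpCat.mono_iff_injective _).mp (inferInstanceAs (Mono ((sections U).map τ)))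

lemma app_app_eq_zero {F G K : X.Modules} {σ : K ⟶ F} {τ : F ⟶ G} (h : σ ≫ τ = 0) (U : X.Opens)
    (x : Γ(K, U)) : τ.app U (σ.app U x) = 0 := by
  rw [← ConcreteCategory.comp_apply, ← Scheme.Modules.Hom.comp_app, h]
  rfl

/-- A section killed by a morphism comes from a section of the kernel. -/
lemma exists_kernel_ι_app_eq {F G : X.Modules} (τ : F ⟶ G) (U : X.Opens) (y : Γ(F, U))
    (hy : τ.app U y = 0) : ∃ k, (kernel.ι τ).app U k = y :=
  (ShortComplex.ab_exact_iff _).mp ((ShortComplex.exact_kernel τ).map_of_mono_of_preservesKernel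
    (sections U) (inferInstanceAs (Mono (kernel.ι τ))) inferInstance) y hy

/-! ### Locality of quasi-coherence and colimits -/

instance : (isQcoh X).IsClosedUnderIsomorphisms :=
  inferInstanceAs (SheafOfModules.isQuasicoherent X.ringCatSheaf).IsClosedUnderIsomorphisms

/-- Presentations of `𝒪_X`-modules are transported along isomorphisms. -/
def presentationOfIso {M N : X.Modules} (e : M ≅ N) (P : M.Presentation) : N.Presentation :=
  have : IsIso (C := SheafOfModules.{u} X.ringCatSheaf) (X := M) (Y := N) e.hom :=
    ⟨e.inv, e.hom_inv_id, e.inv_hom_id⟩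
  SheafOfModules.Presentation.ofIsIso.{u, u, u} (M := M) (N := N) e.hom P

/-- A presentation of the restriction of `M` to an open subscheme gives a presentation of `M` over
this open. -/
def presentationOver (M : X.Modules) (U : X.Opens) (P : (M.restrict U.ι).Presentation) :
    SheafOfModules.Presentation.{u} (SheafOfModules.over M U) :=
  let e : SheafOfModules.{u} (X.ringCatSheaf.over U) ≌
    SheafOfModules.{u} (U : Scheme.{u}).ringCatSheaf := Scheme.Modules.overEquiv U
  let η : SheafOfModules.unit (X.ringCatSheaf.over U) ≅
      e.inverse.obj (SheafOfModules.unit (U : Scheme.{u}).ringCatSheaf) :=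
    e.unitIso.app (SheafOfModules.unit (X.ringCatSheaf.over U))
  let i₀ : e.functor.obj (SheafOfModules.over M U) ≅ M.restrict U.ι :=
    (Scheme.Modules.overFunctorEquiv U).app M
  let i : e.inverse.obj (M.restrict U.ι) ≅ SheafOfModules.over M U :=
    e.inverse.mapIso i₀.symm ≪≫ (e.unitIso.app (SheafOfModules.over M U)).symm
  SheafOfModules.Presentation.ofIsIso.{u, u, u} i.hom
    (SheafOfModules.Presentation.map P e.inverse η)

/-- An `𝒪_X`-module whose restriction to an affine open is quasi-coherent has a presentation
there. -/
def presentationRestrictOfIsQcoh (M : X.Modules) (U : X.Opens) (hU : IsAffineOpen U)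
    (h : isQcoh _ (M.restrict hU.fromSpec)) : (M.restrict U.ι).Presentation :=
  let N := M.restrict hU.fromSpec
  have : IsIso N.fromTildeΓ := (isQuasicoherent_iff_isIso_fromTildeΓ N).mp h
  let P : N.Presentation := presentationOfIso (asIso N.fromTildeΓ)
      (presentationTilde.{u} _ .univ (by simp) _ (Submodule.span_eq _))
  let iso : Scheme.Modules.restrictFunctor hU.fromSpec ⋙
      Scheme.Modules.restrictFunctor hU.isoSpec.hom ≅ Scheme.Modules.restrictFunctor U.ι :=
    (Scheme.Modules.restrictFunctorComp _ _).symm ≪≫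
      Scheme.Modules.restrictFunctorCongr (by rw [← hU.isoSpec_inv_ι, Iso.hom_inv_id_assoc])
  presentationOfIso (iso.app M) (Scheme.Modules.presentationRestrict hU.isoSpec.hom P)

/-- Quasi-coherence can be checked on affine opens. -/
lemma isQcoh_of_affine (M : X.Modules)
    (h : ∀ (U : X.Opens) (hU : IsAffineOpen U), isQcoh _ (M.restrict hU.fromSpec)) :
    isQcoh X M := by
  let d : SheafOfModules.QuasicoherentData.{u} (R := X.ringCatSheaf) M :=
    { I := X.affineOpens
      X := fun U ↦ U.1
      coversTop := (Opens.coversTop_iff _ _).mpr (iSup_affineOpens_eq_top X)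
      presentation := fun U ↦ presentationOver M U.1 (presentationRestrictOfIsQcoh M U.1 U.2 (h U.1 U.2)) }
  exact d.isQuasicoherent

lemma isQcoh_restrict {Y : Scheme.{u}} (f : Y ⟶ X) [IsOpenImmersion f] {M : X.Modules}
    (h : isQcoh X M) : isQcoh Y (M.restrict f) :=
  have : M.IsQuasicoherent := h
  Scheme.Modules.isQuasicoherent_restrictFunctor f M

lemma isQcoh_iff_isLocalizing {R : CommRingCat.{u}} (M : (Spec R).Modules) :
    isQcoh _ M ↔ IsLocalizing (modulesSpecToSheaf.obj M) :=
  (isQuasicoherent_iff_isIso_fromTildeΓ M).trans (isIso_fromTildeΓ_iff_isLocalizing M)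

/-- Colimits of quasi-coherent modules on an affine scheme are quasi-coherent. -/
lemma isQcoh_spec_of_isColimit {R : CommRingCat.{u}} {J : Type*} [Category* J]
    [HasColimitsOfShape J (ModuleCat.{u} R)] {D : J ⥤ (Spec R).Modules} {c : Cocone D}
    (hc : IsColimit c) (hD : ∀ j, isQcoh _ (D.obj j)) : isQcoh _ c.pt := by
  -- The counit identifies `D` with a diagram of tildes, and tilde, a left adjoint, preserves its
  -- colimit.
  let α : D ⋙ moduleSpecΓFunctor ⋙ tilde.functor R ⟶ D :=
    Functor.whiskerLeft D (tilde.adjunction (R := R)).counit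
  have (j : J) : IsIso (α.app j) :=
    (isQuasicoherent_iff_isIso_fromTildeΓ (D.obj j)).mp (hD j)
  have : IsIso α := NatIso.isIso_of_isIso_app α
  let e := (isColimitOfPreserves (tilde.functor R)
    (colimit.isColimit (D ⋙ moduleSpecΓFunctor))).coconePointsIsoOfNatIso hc (asIso α)
  exact (isQcoh _).prop_of_iso e
    (inferInstanceAs ((tilde.functor R).obj (colimit (D ⋙ moduleSpecΓFunctor))).IsQuasicoherent)

/-- Restriction to an affine open preserves colimits, which reduces to the affine case. -/
instance isClosedUnderColimitsOfShape_isQcoh (J : Type*) [Category* J]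
    [∀ R : CommRingCat.{u}, HasColimitsOfShape J (ModuleCat.{u} R)] :
    (isQcoh X).IsClosedUnderColimitsOfShape J where
  colimitsOfShape_le := by
    rintro M ⟨p⟩
    refine isQcoh_of_affine M fun U hU ↦ ?_
    exact isQcoh_spec_of_isColimit
      (isColimitOfPreserves (Scheme.Modules.restrictFunctor hU.fromSpec) p.isColimit)
      fun j ↦ isQcoh_restrict _ (p.prop_diag_obj j)

/-! ### Kernels of quasi-coherent modules -/

/-- In a map of left exact sequences whose last two components are localizations away from `r`,
so is the first one. -/
lemma isLocalizedModule_away_of_exact {R K M N K' M' N' : Type*} [CommRing R]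
    [AddCommGroup K] [AddCommGroup M] [AddCommGroup N] [AddCommGroup K'] [AddCommGroup M']
    [AddCommGroup N'] [Module R K] [Module R M] [Module R N] [Module R K'] [Module R M']
    [Module R N'] {i : K →ₗ[R] M} {g : M →ₗ[R] N} {i' : K' →ₗ[R] M'} {g' : M' →ₗ[R] N'}
    {α : K →ₗ[R] K'} {β : M →ₗ[R] M'} {γ : N →ₗ[R] N'}
    (hi : Function.Injective i) (hi' : Function.Injective i') (hgi' : ∀ x, g' (i' x) = 0)
    (hex : ∀ y, g y = 0 → ∃ x, i x = y)
    (hα : ∀ x, i' (α x) = β (i x)) (hβ : ∀ x, g' (β x) = γ (g x)) (r : R)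
    (hr : IsUnit (algebraMap R (Module.End R K') r))
    [IsLocalizedModule.Away r β] [IsLocalizedModule.Away r γ] :
    IsLocalizedModule.Away r α := by
  refine IsLocalizedModule.Away.mk_of_addCommGroup hr (fun x ↦ ?_) (fun x hx ↦ ?_)
  · obtain ⟨⟨y, ⟨_, n, rfl⟩⟩, hy⟩ := IsLocalizedModule.surj (.powers r) β (i' x)
    replace hy : r ^ n • i' x = β y := hy
    have h0 : γ (g y) = 0 := by rw [← hβ, ← hy, map_smul, hgi', smul_zero]
    obtain ⟨⟨_, m, rfl⟩, hm⟩ := (IsLocalizedModule.eq_zero_iff (.powers r) γ).mp h0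
    replace hm : r ^ m • g y = 0 := hm
    obtain ⟨z, hz⟩ := hex (r ^ m • y) (by rw [map_smul, hm])
    refine ⟨m + n, z, hi' ?_⟩
    rw [hα, hz, map_smul, map_smul, ← hy, pow_add, mul_smul]
  · have h0 : β (i x) = 0 := by rw [← hα, hx, map_zero]
    obtain ⟨⟨_, n, rfl⟩, hn⟩ := (IsLocalizedModule.eq_zero_iff (.powers r) β).mp h0
    exact ⟨n, hi (by rw [map_smul, map_zero]; exact hn)⟩

/-- The kernel of a morphism of quasi-coherent modules on an affine scheme is quasi-coherent. -/
lemma isQcoh_kernel_spec {R : CommRingCat.{u}} {F G : (Spec R).Modules} (τ : F ⟶ G)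
    (hF : isQcoh _ F) (hG : isQcoh _ G) : isQcoh _ (kernel τ) := by
  rw [isQcoh_iff_isLocalizing] at hF hG ⊢
  intro f
  have hFf := hF f
  have hGf := hG f
  let a (M N : (Spec R).Modules) (σ : M ⟶ N) (U : (Spec R).Opens) :=
    ((modulesSpecToSheaf.map σ).hom.app (op U)).hom
  have nat (M N : (Spec R).Modules) (σ : M ⟶ N) (x : Γ(M, ⊤)) :
      a M N σ (PrimeSpectrum.basicOpen f)
        (((modulesSpecToSheaf.obj M).obj.map (PrimeSpectrum.basicOpen f).leTop.op).hom x) =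
      ((modulesSpecToSheaf.obj N).obj.map (PrimeSpectrum.basicOpen f).leTop.op).hom
        (a M N σ ⊤ x) :=
    ConcreteCategory.congr_hom ((modulesSpecToSheaf.map σ).hom.naturality
      (PrimeSpectrum.basicOpen f).leTop.op) x
  exact isLocalizedModule_away_of_exact (i := a _ _ (kernel.ι τ) ⊤) (g := a _ _ τ ⊤)
    (i' := a _ _ (kernel.ι τ) (PrimeSpectrum.basicOpen f))
    (g' := a _ _ τ (PrimeSpectrum.basicOpen f))
    (injective_app_of_mono (kernel.ι τ) ⊤)
    (injective_app_of_mono (kernel.ι τ) (PrimeSpectrum.basicOpen f))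
    (app_app_eq_zero (kernel.condition τ) (PrimeSpectrum.basicOpen f))
    (exists_kernel_ι_app_eq τ ⊤) (nat _ _ _) (nat _ _ _) f
    (Scheme.Modules.isUnit_algebraMap_end_of_le_basicOpen f le_rfl)

/-- Limits are detected on underlying presheaves, where restriction is precomposition with
`f.opensFunctor`. -/
instance {Y : Scheme.{u}} (f : Y ⟶ X) [IsOpenImmersion f] :
    PreservesLimits (Scheme.Modules.restrictFunctor f) := by
  let W : TopCat.Presheaf AddCommGrpCat.{u} X ⥤ TopCat.Presheaf AddCommGrpCat.{u} Y :=
    (Functor.whiskeringLeft Y.Opensᵒᵖ X.Opensᵒᵖ AddCommGrpCat.{u}).obj f.opensFunctor.op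
  have : PreservesLimits W := ⟨fun {J} _ ↦
    inferInstanceAs (PreservesLimitsOfShape J
      ((Functor.whiskeringLeft Y.Opensᵒᵖ X.Opensᵒᵖ AddCommGrpCat.{u}).obj f.opensFunctor.op))⟩
  have : PreservesLimits (Scheme.Modules.restrictFunctor f ⋙ Scheme.Modules.toPresheaf Y) :=
    inferInstanceAs (PreservesLimits (Scheme.Modules.toPresheaf X ⋙ W))
  have : ReflectsLimits (Scheme.Modules.toPresheaf Y) := reflectsLimits_of_reflectsIsomorphisms
  exact preservesLimits_of_reflects_of_preserves _ (Scheme.Modules.toPresheaf Y)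

instance {Y : Scheme.{u}} (f : Y ⟶ X) [IsOpenImmersion f] :
    PreservesFiniteLimits (Scheme.Modules.restrictFunctor f) :=
  PreservesLimits.preservesFiniteLimits _

instance {Y : Scheme.{u}} (f : Y ⟶ X) [IsOpenImmersion f] :
    (Scheme.Modules.restrictFunctor f).PreservesZeroMorphisms :=
  ⟨fun _ _ ↦ rfl⟩

/-- The kernel of a morphism of quasi-coherent modules is quasi-coherent. -/
lemma isQcoh_kernel {F G : X.Modules} (τ : F ⟶ G) (hF : isQcoh X F) (hG : isQcoh X G) :
    isQcoh X (kernel τ) :=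
  isQcoh_of_affine _ fun _ hU ↦ (isQcoh _).prop_of_iso
    (PreservesKernel.iso (Scheme.Modules.restrictFunctor hU.fromSpec) τ).symm
    (isQcoh_kernel_spec _ (isQcoh_restrict _ hF) (isQcoh_restrict _ hG))

/-- The kernel taken in `𝒪_X`-modules is itself quasi-coherent, so a monomorphism of `Qcoh X`
already kills it. -/
instance preservesMonomorphisms_ι : (isQcoh X).ι.PreservesMonomorphisms where
  preserves {F G} τ _ := by
    let K : Qcoh X := ⟨kernel τ.hom, isQcoh_kernel τ.hom F.property G.property⟩
    let k : K ⟶ F := ObjectProperty.homMk (kernel.ι τ.hom)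
    have hk : k = 0 := by
      rw [← cancel_mono τ, zero_comp]
      exact ObjectProperty.hom_ext _ (kernel.condition τ.hom)
    exact Preadditive.mono_of_kernel_zero (congrArg (·.hom) hk)

/-- Lets a monomorphism `E.f` in an exact sequence serve as a kernel of `E.g`. -/
instance : Balanced (Qcoh X) where
  isIso_of_mono_of_epi τ _ _ := by
    have : IsIso ((isQcoh X).ι.map τ) := isIso_of_mono_of_epi _
    exact isIso_of_reflects_iso τ (isQcoh X).ι

/-! ### Affine sections and filtered colimits -/

/-- Restriction of quasi-coherent modules along an open immersion. -/
def qcohRestrict {Y : Scheme.{u}} (f : Y ⟶ X) [IsOpenImmersion f] : Qcoh X ⥤ Qcoh Y :=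
  (isQcoh Y).lift ((isQcoh X).ι ⋙ Scheme.Modules.restrictFunctor f)
    fun M ↦ isQcoh_restrict f M.property

instance {Y : Scheme.{u}} (f : Y ⟶ X) [IsOpenImmersion f] (J : Type u) [SmallCategory J] :
    PreservesColimitsOfShape J (qcohRestrict f) :=
  have : PreservesColimitsOfShape J (qcohRestrict f ⋙ (isQcoh Y).ι) :=
    inferInstanceAs (PreservesColimitsOfShape J
      ((isQcoh X).ι ⋙ Scheme.Modules.restrictFunctor f))
  preservesColimitsOfShape_of_reflects_of_preserves (qcohRestrict f) (isQcoh Y).ι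

/-- Quasi-coherent modules on an affine scheme are modules over the ring of global sections. -/
def qcohSpecEquiv (R : CommRingCat.{u}) : ModuleCat.{u} R ≌ Qcoh (Spec R) := tildeEquiv

/-- On quasi-coherent modules, sections over an affine open commute with filtered colimits. -/
lemma preservesFilteredColimits_sections {U : X.Opens} (hU : IsAffineOpen U)
    (J : Type u) [SmallCategory J] [IsFiltered J] :
    PreservesColimitsOfShape J ((isQcoh X).ι ⋙ sections U) := by
  -- With `U` written as the image of `⊤`, both section functors agree definitionally, so `Iso.refl`
  -- compares them below.
  obtain ⟨R, f, _, rfl⟩ : ∃ (R : CommRingCat.{u}) (f : Spec R ⟶ X) (_ : IsOpenImmersion f),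
      f ''ᵁ ⊤ = U :=
    ⟨_, hU.fromSpec, inferInstance, by simp⟩
  have : PreservesColimitsOfShape J (qcohRestrict f ⋙ (qcohSpecEquiv R).inverse ⋙
      forget₂ (ModuleCat.{u} R) AddCommGrpCat.{u}) := inferInstance
  exact preservesColimitsOfShape_of_natIso (F := qcohRestrict f ⋙ (qcohSpecEquiv R).inverse ⋙
      forget₂ (ModuleCat.{u} R) AddCommGrpCat.{u}) (Iso.refl _)

/-! ### Solving linear systems by purity -/

/-- On sections over an affine open, a pure short exact sequence allows to solve in its first term
those finite systems of linear equations that are solvable in the middle term. -/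
lemma exists_solution_of_pureFp (hX : IsLocallyFinitelyPresented (Qcoh X))
    {E : ShortComplex (Qcoh X)} (hE : pureFp X E) {U : X.Opens} (hU : IsAffineOpen U)
    {n k : ℕ} (a : Fin n → Fin k → Γ(X, U)) (x : Fin n → Γ(E.X₁.obj, U))
    (y : Fin k → Γ(E.X₂.obj, U)) (h : ∀ i, E.f.hom.app U (x i) = ∑ j, a i j • y j) :
    ∃ z : Fin k → Γ(E.X₁.obj, U), ∀ i, x i = ∑ j, a i j • z j := by
  obtain ⟨J, _, _, ⟨p⟩⟩ := hX.exists_colimit E.X₃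
  have := preservesFilteredColimits_sections hU J
  have := hE.1.mono_f
  have : Mono E.f.hom := inferInstanceAs (Mono ((isQcoh X).ι.map E.f))
  have hc := isColimitOfPreserves ((isQcoh X).ι ⋙ sections U) p.isColimit
  let τ := appLinearMap E.f.hom U
  let g := appLinearMap E.g.hom U
  have hgτ (v) : g (τ v) = 0 := app_app_eq_zero (congrArg (·.hom) E.zero) U v
  let ι (i : J) : Γ((p.diag.obj i).obj, U) →ₗ[Γ(X, U)] Γ(E.X₃.obj, U) :=
    appLinearMap (p.ι.app i).hom U
  obtain ⟨i, t, ht⟩ : ∃ (i : J) (t : Fin k → Γ((p.diag.obj i).obj, U)), ∀ j, ι i (t j) = g (y j) :=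
    exists_rep_of_finite hc fun j ↦ g (y j)
  -- In `T(U)` this sum becomes `g (τ (x l)) = 0`, so it dies at a later stage `i'`.
  have h0 (l : Fin n) : ι i (∑ j, a l j • t j) = 0 := by
    simp only [map_sum, map_smul, ht]
    rw [← hgτ (x l), show τ (x l) = _ from h l]
    simp only [map_sum, map_smul]
  obtain ⟨i', φ, hφ⟩ := exists_map_eq_zero_of_finite hc
    (fun l ↦ (∑ j, a l j • t j : Γ((p.diag.obj i).obj, U))) h0
  let d := appLinearMap (p.diag.map φ).hom U
  replace hφ (l : Fin n) : d (∑ j, a l j • t j) = 0 := hφ l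
  have hd (v) : ι i' (d v) = ι i v :=
    ConcreteCategory.congr_hom (congrArg (·.hom.app U) (p.w φ)) v
  obtain ⟨s, hs⟩ : ∃ s : p.diag.obj i' ⟶ E.X₂, s ≫ E.g = p.ι.app i' :=
    (AddCommGrpCat.epi_iff_surjective _).mp
      (hE.2 (p.diag.obj i') (p.prop_diag_obj i')).epi_g (p.ι.app i')
  let σ := appLinearMap s.hom U
  have hσ (v) : g (σ v) = ι i' v :=
    ConcreteCategory.congr_hom (congrArg (·.hom.app U) hs) v
  -- Exactness holds only in `Qcoh X`; it applies to sections because the kernel of `E.g` in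
  -- `𝒪_X`-modules is quasi-coherent and so factors through `E.f`.
  have hlift (v) (hv : g v = 0) : ∃ z, τ z = v := by
    obtain ⟨w, rfl⟩ := exists_kernel_ι_app_eq E.g.hom U v hv
    let K : Qcoh X := ⟨kernel E.g.hom, isQcoh_kernel _ E.X₂.property E.X₃.property⟩
    let κ : K ⟶ E.X₂ := ObjectProperty.homMk (kernel.ι E.g.hom)
    obtain ⟨l, hl⟩ : ∃ l : K ⟶ E.X₁, l ≫ E.f = κ :=
      ⟨_, hE.1.exact.lift_f κ (ObjectProperty.hom_ext _ (kernel.condition E.g.hom))⟩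
    exact ⟨l.hom.app U w, ConcreteCategory.congr_hom (congrArg (·.hom.app U) hl) w⟩
  choose z hz using fun j ↦ hlift (y j - σ (d (t j)))
    (by rw [map_sub, hσ, hd, ht, sub_self])
  refine ⟨z, fun l ↦ injective_app_of_mono E.f.hom U ?_⟩
  change τ (x l) = τ (∑ j, a l j • z j)
  have hτ : τ (x l) = ∑ j, a l j • y j := h l
  have h1 := congrArg σ (hφ l)
  simp only [map_sum, map_smul, map_zero] at h1
  simp only [map_sum, map_smul, hz, smul_sub, Finset.sum_sub_distrib, h1, sub_zero, hτ]

end QcohPurity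

end

theorem mainTheorem5 (X : AlgebraicGeometry.Scheme.{u})
    (hX : QcohPurity.IsLocallyFinitelyPresented (QcohPurity.Qcoh X)) :
    QcohPurity.pureFp X ≤ QcohPurity.pure X := by
  intro E hE
  have := hE.1.mono_f
  refine ⟨hE.1, inferInstance, fun M ↦ ?_⟩
  exact QcohPurity.mono_tensorLeftFunctor_map _ M fun U hU ↦
    QcohPurity.lTensor_injective_of_forall_exists_solution _ fun n k a x y h ↦
      QcohPurity.exists_solution_of_pureFp hX hE hU a x y h
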